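/- **Setting.** An *extensional Kan complex* $\langle K,F,G,\varepsilon,\eta\rangle$ is a Kan complex $K$ with simplicial maps $F:K\to[K\to K]$, $G:[K\to K]\to K$, where $[K\to K]=\mathrm{Fun}(K,K)$, and natural equivalences (homotopies) $\varepsilon: FG\to 1_{[K\to K]}$ and $\eta:1_K\to GF$. Put $f\bullet g=F(f)(g)$. Untyped $\lambda$-terms are interpreted under valuations $\rho$ of the variables in $K$ by $[\![x]\!]_\rho=\rho(x)$, $[\![MN]\!]_\rho=[\![M]\!]_\rho\bullet[\![N]\!]_\rho$, $[\![\lambda x.M]\!]_\rho=G(f\mapsto[\![M]\!]_{[f/x]\rho})$; in particular, for $\rho$ with values in the vertices of $K$ there is a map $[\![P]\!]_{[- /x]\rho}:K\to K$. For a simplicial set $X$ with vertices $a,b$ let $X(a,b)$ be the fibre of $\mathrm{Fun}(\Delta^1,X)\to X\times X$ over $(a,b)$. An *$n$-cell* of $X$ is a vertex of an iterated mapping space $X(a_0,b_0)(a_1,b_1)\cdots(a_{n-1},b_{n-1})$, where $a_i,b_i$ are vertices of $X(a_0,b_0)\cdots(a_{i-1},b_{i-1})$; for $n\ge1$ it goes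 from the $(n-1)$-cell $a_{n-1}$ to the $(n-1)$-cell $b_{n-1}$. Simplicial maps act on cells. Let $\Lambda_0$ be the set of $\lambda$-terms. For $n\ge 1$, an $n$-conversion $t\in\Lambda_n$ consists of two $\lambda$-terms $M,N$ and, for every extensional Kan complex and every valuation $\rho$ in its vertices, an $n$-cell $[\![t]\!]_\rho$ of $K$ with $a_0=[\![M]\!]_\rho$ and $b_0=[\![N]\!]_\rho$. Its source $r$ and target $s$ are elements of $\Lambda_{n-1}$, and one writes $t\in\Lambda_n(r,s)$. The variable $y$ is not free in $t$ if $y\notin FV(M)\cup FV(N)$ and $[\![t]\!]_\rho$ does not depend on $\rho(y)$. For $t\in\Lambda_n$ with $n\geq1$ put $[\![(\lambda x.P)t]\!]_\rho=[\![\lambda x.P]\!]_\rho\bullet[\![t]\!]_\rho$, $[\![[t/x]P]\!]_\rho=[\![P]\!]_{[- /x]\rho}([\![t]\!]_\rho)$ and, if $y$ is not free in $t$, $[\![\lambda y.ty]\!]_\rho=G(F([\![t]\!]_\rho))$; for $t\in\Lambda_0$ these are the interpretations of the $\lambda$-terms $(\lambda x.P)t$, $[t/x]P$ (capture-avoiding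 substitution) and $\lambda y.ty$. The components $a\mapsto\big((\varepsilon_g)_a:FG(g)(a)\to g(a)\big)$ of $\varepsilon$ at $g=[\![P]\!]_{[- /x]\rho}$ form a map $K\to\mathrm{Fun}(\Delta^1,K)$. For $t\in\Lambda_n$, $n\ge0$, the interpretation of the $(n+1)\beta$-contraction $(n+1)\beta_t:(\lambda x.P)t\to[t/x]P$ is the image of $[\![t]\!]_\rho$ under this map, an $n$-cell of $\mathrm{Fun}(\Delta^1,K)$. The interpretation of the $(n+1)\eta$-contraction $(n+1)\eta_t:\lambda y.ty\to t$ is, likewise, the image of $[\![t]\!]_\rho$ under the components of an inverse $\tilde\eta:GF\to1_K$ of $\eta$ (up to homotopy). **Corollary 2.1.** Let $n\ge1$, $r,s\in\Lambda_{n-1}$, $t\in\Lambda_n(r,s)$, let $x,y$ be variables and $P$ a $\lambda$-term, with $y$ not free in $t$ for the second square. In every extensional Kan complex, for every valuation $\rho$ in its vertices, an inverse $\tilde\eta$ of $\eta$ exists, and, for every such $\tilde\eta$, the interpretations of the squares $$\begin{array}{ccc}(\lambda x.P)r&\xrightarrow{\;n\beta_r\;}&[r/x]P\\ {\scriptstyle(\lambda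 x.P)t}\downarrow&&\downarrow{\scriptstyle[t/x]P}\\ (\lambda x.P)s&\xrightarrow{\;n\beta_s\;}&[s/x]P\end{array}\qquad\qquad\begin{array}{ccc}\lambda y.ry&\xrightarrow{\;n\eta_r\;}&r\\ {\scriptstyle\lambda y.ty}\downarrow&&\downarrow{\scriptstyle t}\\ \lambda y.sy&\xrightarrow{\;n\eta_s\;}&s\end{array}$$ commute: the sides have the indicated ends, and there is an $n$-cell of $\mathrm{Fun}(\Delta^1,K)$ from the upper to the lower horizontal side whose images under the evaluations at $0$ and $1$ are the left and the right vertical side (for $n=1$: a map $\Delta^1\times\Delta^1\to K$ with the four given sides). Such $n$-cells are given by the interpretations of the $(n+1)\beta$-contraction $(n+1)\beta_t$ and of the $(n+1)\eta$-contraction $(n+1)\eta_t$, respectively. -/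

import Mathlib

open CategoryTheory MonoidalCategory CartesianMonoidalCategory

universe u

noncomputable section

namespace HigherLambda

/-! ### The untyped λ-calculus -/

/-- The (countably infinite) set of variables. -/
abbrev Var : Type := ℕ

/-- Untyped λ-terms with named variables. -/
inductive Term : Type
  | var (x : Var) : Term
  | app (M N : Term) : Term
  | lam (x : Var) (M : Term) : Term

namespace Term

/-- The free variables of a term. -/
def FV : Term → Finset Var
  | var x => {x}
  | app M N => M.FV ∪ N.FV
  | lam x M => M.FV.erase x

/-- Simultaneous capture-avoiding substitution: a bound variable is renamed exactly when it would
capture a free variable of one of the substituted terms. -/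
def substAll : Term → (Var → Term) → Term
  | var x, σ => σ x
  | app M N, σ => app (M.substAll σ) (N.substAll σ)
  | lam x M, σ =>
      let S : Finset Var := (M.FV.erase x).biUnion fun v => (σ v).FV
      let z : Var := if x ∈ S then S.sup id + 1 else x
      lam z (M.substAll (Function.update σ x (var z)))

/-- `[N/x]P`. -/
def subst (N : Term) (x : Var) (P : Term) : Term :=
  P.substAll (Function.update var x N)

end Term

/-! ### Arrow complexes, mapping spaces and their iteration -/

section

open Simplicial

/-- The vertices of a simplicial set. -/
abbrev Vertex (X : SSet.{u}) : Type u := X _⦋0⦌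

/-- The function complex `[X → Y] = Fun(X, Y)`. -/
abbrev Fun (X Y : SSet.{u}) : SSet.{u} := (ihom X).obj Y

/-- The arrow complex `Fun(Δ¹, X)`. -/
abbrev Arr (X : SSet.{u}) : SSet.{u} := Fun (Δ[1] : SSet.{u}) X

/-- Evaluation `Fun(Δ¹, X) ⟶ X` at the vertex `i` of `Δ¹`. -/
def evAt (X : SSet.{u}) (i : Fin 2) : Arr X ⟶ X :=
  lift (SSet.const (SSet.stdSimplex.obj₀Equiv.symm i)) (𝟙 (Arr X)) ≫
    (ihom.ev (Δ[1] : SSet.{u})).app X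

theorem map_comp_evAt {X Y : SSet.{u}} (f : X ⟶ Y) (i : Fin 2) :
    (ihom (Δ[1] : SSet.{u})).map f ≫ evAt Y i = evAt X i ≫ f := by
  rfl

theorem app_mem_ofSimplex {X Y : SSet.{u}} (f : X ⟶ Y) (a : Vertex X) {m : SimplexCategoryᵒᵖ}
    (y : X.obj m) (hy : y ∈ (SSet.Subcomplex.ofSimplex a).obj m) :
    f.app m y ∈ (SSet.Subcomplex.ofSimplex (f.app _ a)).obj m := by
  rw [SSet.Subcomplex.mem_ofSimplex_obj_iff] at hy ⊢
  obtain ⟨g, rfl⟩ := hy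
  exact ⟨g, (NatTrans.naturality_apply f g.op a).symm⟩

/-- The mapping space `X(a,b)`: the fibre of `Fun(Δ¹, X) ⟶ X × X` over `(a,b)`. -/
def mapSpace {X : SSet.{u}} (a b : Vertex X) : (Arr X).Subcomplex :=
  (SSet.Subcomplex.ofSimplex a).preimage (evAt X 0) ⊓
    (SSet.Subcomplex.ofSimplex b).preimage (evAt X 1)

/-- The map `X(a,b) ⟶ Y(f a, f b)` induced by `f : X ⟶ Y`. -/
def mapSpaceMap {X Y : SSet.{u}} (f : X ⟶ Y) (a b : Vertex X) :
    (mapSpace a b : SSet.{u}) ⟶ (mapSpace (f.app _ a) (f.app _ b) : SSet.{u}) :=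
  SSet.Subcomplex.lift ((mapSpace a b).ι ≫ (ihom (Δ[1] : SSet.{u})).map f) (by
    rintro m _ ⟨⟨c, hc⟩, rfl⟩
    exact ⟨app_mem_ofSimplex f a _ hc.1, app_mem_ofSimplex f b _ hc.2⟩)

end

/-- The `n`-cells of `X`: the vertices of the iterated mapping spaces
`X(a₀,b₀)(a₁,b₁)⋯(aₙ₋₁,bₙ₋₁)`, recorded together with all the `aᵢ` and `bᵢ`. -/
def Cell : ℕ → SSet.{u} → Type u
  | 0, X => Vertex X
  | n + 1, X => Σ a b : Vertex X, Cell n (mapSpace a b : SSet.{u})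

namespace Cell

/-- The action of a simplicial map on cells. -/
def map : ∀ {n : ℕ} {X Y : SSet.{u}}, (X ⟶ Y) → Cell n X → Cell n Y
  | 0, _, _, f, a => f.app _ a
  | _ + 1, _, _, f, ⟨a, b, c⟩ => ⟨f.app _ a, f.app _ b, map (mapSpaceMap f a b) c⟩

/-- The source of an `(n+1)`-cell: the last of the `aᵢ`. -/
def src : ∀ {n : ℕ} {X : SSet.{u}}, Cell (n + 1) X → Cell n X
  | 0, _, ⟨a, _, _⟩ => a
  | _ + 1, _, ⟨a, b, c⟩ => ⟨a, b, src c⟩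

/-- The target of an `(n+1)`-cell: the last of the `bᵢ`. -/
def tgt : ∀ {n : ℕ} {X : SSet.{u}}, Cell (n + 1) X → Cell n X
  | 0, _, ⟨_, b, _⟩ => b
  | _ + 1, _, ⟨a, b, c⟩ => ⟨a, b, tgt c⟩

/-- The domain of an `n`-cell of arrows of `X`. -/
def dom {n : ℕ} {X : SSet.{u}} (c : Cell n (Arr X)) : Cell n X := c.map (evAt X 0)

/-- The codomain of an `n`-cell of arrows of `X`. -/
def cod {n : ℕ} {X : SSet.{u}} (c : Cell n (Arr X)) : Cell n X := c.map (evAt X 1)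

end Cell

/-- The square with corners `a`, `b`, `c`, `d`, horizontal sides `top : a → b`, `bot : c → d` and
vertical sides `left : a → c`, `right : b → d` commutes by means of `σ`. The corners are `n`-cells
of `X`, the vertical sides are `(n+1)`-cells of `X`, and the horizontal sides are `n`-cells of
arrows of `X`, as they need not fix the lower-dimensional boundary of the corners. For `n = 0`,
`σ` is an edge of `Fun(Δ¹, X)`, that is, a map `Δ¹ × Δ¹ ⟶ X` with the four given sides. For
`n > 0`, `σ` lies in an iterated mapping space of `Fun(Δ¹, X)`, so that the square is filled
relative to the lower-dimensional boundaries of its sides. -/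
structure CommutesVia {n : ℕ} {X : SSet.{u}} (σ : Cell (n + 1) (Arr X)) (a b c d : Cell n X)
    (top bot : Cell n (Arr X)) (left right : Cell (n + 1) X) : Prop where
  top_dom : top.dom = a
  top_cod : top.cod = b
  bot_dom : bot.dom = c
  bot_cod : bot.cod = d
  left_src : left.src = a
  left_tgt : left.tgt = c
  right_src : right.src = b
  right_tgt : right.tgt = d
  src_eq : σ.src = top
  tgt_eq : σ.tgt = bot
  dom_eq : σ.dom = left
  cod_eq : σ.cod = right

/-! ### Reflexive and extensional Kan complexes -/

section

open Simplicial

/-- A reflexive Kan complex. As the target of `ε` is a Kan complex, a natural equivalence is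
the same thing as a homotopy. -/
structure ReflexiveKan where
  K : SSet.{u}
  kan : SSet.KanComplex K
  F : K ⟶ Fun K K
  G : Fun K K ⟶ K
  ε : SSet.Homotopy (G ≫ F) (𝟙 (Fun K K))

/-- An extensional Kan complex. -/
structure ExtensionalKan extends ReflexiveKan.{u} where
  η : SSet.Homotopy (𝟙 K) (F ≫ G)

/-- The map `X ⟶ Fun(Δ¹, Y)`, `a ↦ (f a → g a)`, given by the components of a homotopy. -/
def component {X Y : SSet.{u}} {f g : X ⟶ Y} (H : SSet.Homotopy f g) : X ⟶ Arr Y :=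
  MonoidalClosed.curry (lift (snd _ _) (fst _ _) ≫ H.h)

/-- `H'` is inverse to `H` up to homotopy: in `Fun(X, Y)` there are 2-simplices exhibiting the
identities as composites of `H` and `H'`, in both orders. -/
def AreInverse {X Y : SSet.{u}} {f g : X ⟶ Y} (H : SSet.Homotopy f g) (H' : SSet.Homotopy g f) :
    Prop :=
  (∃ T : X ⊗ (Δ[2] : SSet.{u}) ⟶ Y,
      X ◁ SSet.stdSimplex.δ 2 ≫ T = H.h ∧ X ◁ SSet.stdSimplex.δ 0 ≫ T = H'.h ∧
        X ◁ SSet.stdSimplex.δ 1 ≫ T = fst _ _ ≫ f) ∧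
  (∃ T : X ⊗ (Δ[2] : SSet.{u}) ⟶ Y,
      X ◁ SSet.stdSimplex.δ 2 ≫ T = H'.h ∧ X ◁ SSet.stdSimplex.δ 0 ≫ T = H.h ∧
        X ◁ SSet.stdSimplex.δ 1 ≫ T = fst _ _ ≫ g)

end

namespace ReflexiveKan

variable (R : ReflexiveKan.{u})

/-- Application `f • g = F(f)(g)`, for `f` and `g` depending on a parameter in `X`. -/
def app {X : SSet.{u}} (f g : X ⟶ R.K) : X ⟶ R.K :=
  lift g (f ≫ R.F) ≫ (ihom.ev R.K).app R.K

/-- The valuation `[f/x]ρ`. -/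
def updateVal {X : SSet.{u}} (ρ : Var → (X ⟶ R.K)) (x : Var) (f : X ⟶ R.K) : Var → (X ⟶ R.K) :=
  Function.update ρ x f

/-- The interpretation of a term under a valuation of the variables by elements of `K` with
parameters in `X`; for `X = Δⁿ` these are the `n`-simplices of `K`. The map
`f ↦ ⟦M⟧_{[f/x]ρ}` is the transpose `X ⟶ [K → K]` of the interpretation of `M` with parameters
in `K × X`. -/
def interp : Term → ∀ {X : SSet.{u}}, (Var → (X ⟶ R.K)) → (X ⟶ R.K)
  | .var x, _, ρ => ρ x
  | .app M N, _, ρ => R.app (interp M ρ) (interp N ρ)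
  | .lam x M, X, ρ =>
      MonoidalClosed.curry
        (interp M (R.updateVal (fun v => snd R.K X ≫ ρ v) x (fst R.K X))) ≫ R.G

end ReflexiveKan

section

open Simplicial

namespace ReflexiveKan

variable (R : ReflexiveKan.{u})

/-- `⟦M⟧_ρ`, an `n`-simplex of `K`, for a valuation `ρ` in the `n`-simplices of `K`. -/
def interpSimplex {n : ℕ} (M : Term) (ρ : Var → R.K _⦋n⦌) : R.K _⦋n⦌ :=
  SSet.yonedaEquiv (R.interp M fun v => SSet.yonedaEquiv.symm (ρ v))

/-- Valuations in the vertices of `K`. -/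
abbrev Valuation : Type u := Var → Vertex R.K

/-- The functor `⟦P⟧_{[·/x]ρ} : K ⟶ K`. -/
def interpFun (x : Var) (P : Term) (ρ : R.Valuation) : R.K ⟶ R.K :=
  R.interp P (R.updateVal (fun v => SSet.const (ρ v)) x (𝟙 R.K))

/-- The functor `F(a) = a • (-) : K ⟶ K`. -/
def appLeft (a : Vertex R.K) : R.K ⟶ R.K :=
  R.app (SSet.const a) (𝟙 R.K)

/-- The components `(ε_g)_a : F(G(g))(a) → g(a)` of `ε` at `g : K ⟶ K`, as a map in `a`. -/
def epsilonAt (g : R.K ⟶ R.K) : R.K ⟶ Arr R.K :=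
  MonoidalClosed.curry
    (lift (snd _ _)
      (lift (MonoidalClosed.curry (fst R.K ((Δ[1] : SSet.{u}) ⊗ R.K) ≫ g)) (fst _ _) ≫ R.ε.h) ≫
      (ihom.ev R.K).app R.K)

end ReflexiveKan

end

/-! ### Higher conversions -/

/-- The families `Λ_n`: `Λ_0` consists of the λ-terms, and an element of `Λ_{n+1}` is an
`(n+1)`-conversion, i.e. two λ-terms `M`, `N` together with, in every extensional Kan complex and
for every valuation `ρ`, a vertex of an `n`-fold iterated mapping space of `K(⟦M⟧_ρ, ⟦N⟧_ρ)`. -/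
inductive Conv : ℕ → Type (u + 1)
  | term (M : Term) : Conv 0
  | conv {n : ℕ} (M N : Term)
      (c : ∀ (E : ExtensionalKan.{u}) (ρ : E.Valuation),
        Cell n (mapSpace (E.interpSimplex M ρ) (E.interpSimplex N ρ) : SSet.{u})) : Conv (n + 1)

namespace Conv

/-- The source of an `(n+1)`-conversion. -/
def src : ∀ {n : ℕ}, Conv.{u} (n + 1) → Conv.{u} n
  | 0, conv M _ _ => term M
  | _ + 1, conv M N c => conv M N fun E ρ => (c E ρ).src

/-- The target of an `(n+1)`-conversion. -/
def tgt : ∀ {n : ℕ}, Conv.{u} (n + 1) → Conv.{u} n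
  | 0, conv _ N _ => term N
  | _ + 1, conv M N c => conv M N fun E ρ => (c E ρ).tgt

/-- `t` is a conversion from `r` to `s`. -/
def Between {n : ℕ} (t : Conv.{u} (n + 1)) (r s : Conv.{u} n) : Prop :=
  t.src = r ∧ t.tgt = s

variable (E : ExtensionalKan.{u}) (ρ : E.Valuation)

/-- The interpretation `⟦t⟧_ρ`. -/
def interp : ∀ {n : ℕ}, Conv.{u} n → Cell n E.K
  | _, term M => E.interpSimplex M ρ
  | _, conv M N c => ⟨E.interpSimplex M ρ, E.interpSimplex N ρ, c E ρ⟩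

/-- `y ∉ FV(t)`: the variable `y` is not free in the underlying λ-terms, and the interpretation of
`t` does not depend on the value of `y`. -/
def NotFree (y : Var) : ∀ {n : ℕ}, Conv.{u} n → Prop
  | _, term M => y ∉ M.FV
  | _, conv M N c => y ∉ M.FV ∧ y ∉ N.FV ∧
      ∀ (E : ExtensionalKan.{u}) (ρ : E.Valuation) (a : Vertex E.K),
        (conv M N c).interp E (Function.update ρ y a) = (conv M N c).interp E ρ

/-- The interpretation of `(λx.P)t`. For a higher conversion `t` it is `⟦λx.P⟧_ρ • ⟦t⟧_ρ`. -/
def betaRedex (x : Var) (P : Term) : ∀ {n : ℕ}, Conv.{u} n → Cell n E.K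
  | _, term M => E.interpSimplex (.app (.lam x P) M) ρ
  | _, conv M N c =>
      ((conv M N c).interp E ρ).map (E.appLeft (E.interpSimplex (.lam x P) ρ))

/-- The interpretation of `[t/x]P`. For a higher conversion `t` it is `⟦P⟧_{[⟦t⟧_ρ/x]ρ}`. -/
def betaContractum (x : Var) (P : Term) : ∀ {n : ℕ}, Conv.{u} n → Cell n E.K
  | _, term M => E.interpSimplex (Term.subst M x P) ρ
  | _, conv M N c => ((conv M N c).interp E ρ).map (E.interpFun x P ρ)

/-- The interpretation of `λy.ty`, for `y ∉ FV(t)`. For a higher conversion `t` it is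
`G(f ↦ ⟦t⟧_ρ • f)`, and `f ↦ ⟦t⟧_ρ • f` is `F(⟦t⟧_ρ)`. -/
def etaRedex (y : Var) : ∀ {n : ℕ}, Conv.{u} n → Cell n E.K
  | _, term M => E.interpSimplex (.lam y (.app M (.var y))) ρ
  | _, conv M N c => ((conv M N c).interp E ρ).map (E.F ≫ E.G)

/-- The interpretation of the `(n+1)β`-contraction `(λx.P)t → [t/x]P` at `t ∈ Λ_n`: the component
at `⟦t⟧_ρ` of the natural equivalence induced by `ε` at `⟦P⟧_{[·/x]ρ}`. -/
def beta (x : Var) (P : Term) {n : ℕ} (t : Conv.{u} n) : Cell n (Arr E.K) :=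
  (t.interp E ρ).map (E.epsilonAt (E.interpFun x P ρ))

/-- The interpretation of the `(n+1)η`-contraction `λy.ty → t` at `t ∈ Λ_n`: the component at
`⟦t⟧_ρ` of an inverse `θ` of the natural equivalence `η`. -/
def eta (θ : SSet.Homotopy (E.F ≫ E.G) (𝟙 E.K)) {n : ℕ} (t : Conv.{u} n) : Cell n (Arr E.K) :=
  (t.interp E ρ).map (component θ)

end Conv

end HigherLambda

end

open HigherLambda

/-! Both squares are naturality squares. A simplicial map `h : X ⟶ Arr Y` whose evaluations at 0 and
1 are `f` and `g` is a transformation from `f` to `g`. The action of maps on cells respects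
composition, sources and targets strictly, so for a cell `c` the cell `c.map h` runs from `c.src.map
h` to `c.tgt.map h` and has ends `c.map f` and `c.map g`. This is `commutesVia_map`, and no homotopy
has to be constructed for it.

For β, `h` consists of the components of `ε` at `⟦P⟧_{[·/x]ρ}`, with ends `⟦λx.P⟧ • (-)` and
`⟦P⟧_{[·/x]ρ}`. For η, it consists of the components of the inverse homotopy, with ends `GF` and the
identity. On higher conversions the sides are images under these ends by definition. On λ-terms this
needs semantics: compositionality for application, the substitution lemma `interp_substAll`, and
`interp_lam_app_var` for `λy.My`.

The inverse of `η` exists because `Fun(K, K)` is a Kan complex, in which edges are inverted by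
filling horns. -/

noncomputable section

namespace HigherLambda

/-! ### The action of simplicial maps on cells -/

namespace Cell

/-- An `n`-cell of the mapping space `X(a,b)`, as an `(n+1)`-cell of `X`. -/
def cons {n : ℕ} {X : SSet.{u}} (a b : Vertex X) (c : Cell n (mapSpace a b : SSet.{u})) :
    Cell (n + 1) X :=
  ⟨a, b, c⟩

theorem map_id : ∀ {n : ℕ} {X : SSet.{u}} (c : Cell n X), c.map (𝟙 X) = c
  | 0, _, _ => rfl
  | _ + 1, _, ⟨a, b, c⟩ => congrArg (cons a b) (map_id c)

/-- The map induced on mapping spaces by a composite is definitionally the composite of the induced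
maps, so the induction needs no transport. -/
theorem map_map : ∀ {n : ℕ} {X Y Z : SSet.{u}} (f : X ⟶ Y) (g : Y ⟶ Z) (c : Cell n X),
    (c.map f).map g = c.map (f ≫ g)
  | 0, _, _, _, _, _, _ => rfl
  | _ + 1, _, _, _, f, g, ⟨a, b, c⟩ =>
    congrArg (cons (g.app _ (f.app _ a)) (g.app _ (f.app _ b)))
      (map_map (mapSpaceMap f a b) (mapSpaceMap g _ _) c)

theorem src_map : ∀ {n : ℕ} {X Y : SSet.{u}} (f : X ⟶ Y) (c : Cell (n + 1) X),
    (c.map f).src = c.src.map f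
  | 0, _, _, _, ⟨_, _, _⟩ => rfl
  | _ + 1, _, _, f, ⟨a, b, c⟩ =>
    congrArg (cons (f.app _ a) (f.app _ b)) (src_map (mapSpaceMap f a b) c)

theorem tgt_map : ∀ {n : ℕ} {X Y : SSet.{u}} (f : X ⟶ Y) (c : Cell (n + 1) X),
    (c.map f).tgt = c.tgt.map f
  | 0, _, _, _, ⟨_, _, _⟩ => rfl
  | _ + 1, _, _, f, ⟨a, b, c⟩ =>
    congrArg (cons (f.app _ a) (f.app _ b)) (tgt_map (mapSpaceMap f a b) c)

end Cell

theorem commutesVia_map {n : ℕ} {X Y : SSet.{u}} (h : X ⟶ Arr Y) (f g : X ⟶ Y)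
    (hf : h ≫ evAt Y 0 = f) (hg : h ≫ evAt Y 1 = g) (c : Cell (n + 1) X) :
    CommutesVia (c.map h) (c.src.map f) (c.src.map g) (c.tgt.map f) (c.tgt.map g)
      (c.src.map h) (c.tgt.map h) (c.map f) (c.map g) := by
  subst hf hg
  constructor <;> simp only [Cell.dom, Cell.cod, Cell.map_map, Cell.src_map, Cell.tgt_map]

/-! ### Components of homotopies -/

open Simplicial in
theorem curry_comp_evAt {X Y : SSet.{u}} (k : Δ[1] ⊗ X ⟶ Y) (i : Fin 2) :
    MonoidalClosed.curry k ≫ evAt Y i =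
      lift (SSet.const (SSet.stdSimplex.obj₀Equiv.symm i)) (𝟙 X) ≫ k := by
  conv_rhs => rw [← MonoidalClosed.uncurry_curry k, MonoidalClosed.uncurry_eq]
  simp only [evAt, ← Category.assoc, comp_lift, lift_whiskerLeft]
  simp

theorem component_comp_evAt_zero {X Y : SSet.{u}} {f g : X ⟶ Y} (H : SSet.Homotopy f g) :
    component H ≫ evAt Y 0 = f := by
  rw [component, curry_comp_evAt, ← Category.assoc]
  exact H.h₀

theorem component_comp_evAt_one {X Y : SSet.{u}} {f g : X ⟶ Y} (H : SSet.Homotopy f g) :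
    component H ≫ evAt Y 1 = g := by
  rw [component, curry_comp_evAt, ← Category.assoc]
  exact H.h₁

/-! ### Interpretation of terms -/

open Simplicial in
theorem yonedaEquiv_symm_comp {X Y : SSet.{u}} {n : ℕ} (f : X ⟶ Y) (a : X _⦋n⦌) :
    SSet.yonedaEquiv.symm a ≫ f = SSet.yonedaEquiv.symm (f.app _ a) := by
  apply SSet.yonedaEquiv.injective
  simp

theorem yonedaEquiv_symm_eq_const {X : SSet.{u}} (a : Vertex X) :
    SSet.yonedaEquiv.symm a = SSet.const a := by
  apply SSet.yonedaEquiv.injective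
  simp

namespace ReflexiveKan

variable (R : ReflexiveKan.{u})

theorem comp_app {X Y : SSet.{u}} (h : Y ⟶ X) (f g : X ⟶ R.K) :
    h ≫ R.app f g = R.app (h ≫ f) (h ≫ g) := by
  simp [app, ← Category.assoc, comp_lift]

theorem updateVal_self {X : SSet.{u}} (ρ : Var → (X ⟶ R.K)) (x : Var) (f : X ⟶ R.K) :
    R.updateVal ρ x f x = f := Function.update_self ..

theorem updateVal_of_ne {X : SSet.{u}} (ρ : Var → (X ⟶ R.K)) {x v : Var} (f : X ⟶ R.K)
    (h : v ≠ x) : R.updateVal ρ x f v = ρ v := Function.update_of_ne h ..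

theorem interp_congr (M : Term) : ∀ {X : SSet.{u}} (ρ ρ' : Var → (X ⟶ R.K)),
    (∀ v ∈ M.FV, ρ v = ρ' v) → R.interp M ρ = R.interp M ρ' := by
  induction M with
  | var x => intro X ρ ρ' h; exact h x (by simp [Term.FV])
  | app M N ihM ihN =>
    intro X ρ ρ' h
    simp only [interp]
    rw [ihM ρ ρ' fun v hv => h v (by simp [Term.FV, hv]),
      ihN ρ ρ' fun v hv => h v (by simp [Term.FV, hv])]
  | lam x M ih =>
    intro X ρ ρ' h
    simp only [interp]
    congr 2
    refine ih _ _ fun v hv => ?_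
    by_cases hx : v = x
    · subst hx; simp only [updateVal_self]
    · simp only [updateVal_of_ne _ _ _ hx, h v (by simp [Term.FV, hv, hx])]

/-- Naturality in the parameter complex. At an abstraction it is naturality of currying: the bound
variable is the projection to `K`, which `K ◁ h` leaves unchanged. -/
theorem comp_interp (M : Term) : ∀ {X Y : SSet.{u}} (h : Y ⟶ X) (ρ : Var → (X ⟶ R.K)),
    h ≫ R.interp M ρ = R.interp M (fun v => h ≫ ρ v) := by
  induction M with
  | var x => intros; rfl
  | app M N ihM ihN => intro X Y h ρ; simp only [interp, comp_app, ihM, ihN]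
  | lam x M ih =>
    intro X Y h ρ
    simp only [interp]
    rw [← Category.assoc, ← MonoidalClosed.curry_natural_left, ih]
    congr 3
    funext v
    by_cases hx : v = x
    · subst hx; simp only [updateVal_self]; simp
    · simp only [updateVal_of_ne _ _ _ hx]; simp

/-- The substitution lemma. Under a binder, the renamed variable is not free in any of the
substituted terms that matter, so updating the valuation there does not affect their
interpretations. -/
theorem interp_substAll (M : Term) : ∀ {X : SSet.{u}} (σ : Var → Term) (ρ : Var → (X ⟶ R.K)),
    R.interp (M.substAll σ) ρ = R.interp M (fun v => R.interp (σ v) ρ) := by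
  induction M with
  | var x => intros; rfl
  | app M N ihM ihN => intro X σ ρ; simp only [Term.substAll, interp, ihM, ihN]
  | lam x M ih =>
    intro X σ ρ
    simp only [Term.substAll, interp, ih]
    congr 2
    refine R.interp_congr M _ _ fun v hv => ?_
    by_cases hx : v = x
    · subst hx; simp only [updateVal_self, Function.update_self, interp]
    · simp only [updateVal_of_ne _ _ _ hx, Function.update_of_ne hx, comp_interp]
      refine R.interp_congr _ _ _ fun w hw => updateVal_of_ne _ _ _ ?_
      have hS : w ∈ (M.FV.erase x).biUnion fun v => (σ v).FV :=
        Finset.mem_biUnion.2 ⟨v, Finset.mem_erase.2 ⟨hx, hv⟩, hw⟩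
      rintro rfl
      -- The new bound variable avoids the captured set in both cases: it is either larger than
      -- every element, or the old variable, which was not in the set.
      split_ifs at hS with h
      · exact Nat.not_succ_le_self _ (Finset.le_sup (f := id) hS)
      · exact h hS

/-- Constant maps factor through `Δ[0]`, where `interpSimplex` is computed, so `comp_interp`
applies. -/
theorem const_interpSimplex {X : SSet.{u}} (M : Term) (ρ : R.Valuation) :
    (SSet.const (R.interpSimplex M ρ) : X ⟶ R.K) = R.interp M fun v => SSet.const (ρ v) := by
  have h (a : Vertex R.K) : (SSet.const a : X ⟶ R.K) =
      SSet.const (SSet.stdSimplex.obj₀Equiv.symm 0) ≫ SSet.yonedaEquiv.symm a := by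
    rw [yonedaEquiv_symm_eq_const, SSet.comp_const]
  simp only [h]
  rw [← comp_interp, interpSimplex, Equiv.symm_apply_apply]

/-! ### The ends of the components of `ε` -/

/-- A map `X ⟶ [X → Y]` with constant value `g`, evaluated on the diagonal, is `g`. -/
theorem lift_curry_fst_comp_ev {X Y : SSet.{u}} (g : X ⟶ Y) :
    lift (𝟙 X) (MonoidalClosed.curry (fst X X ≫ g)) ≫ (ihom.ev X).app Y = g := by
  have := MonoidalClosed.uncurry_curry (fst X X ≫ g)
  rw [MonoidalClosed.uncurry_eq] at this
  calc _ = lift (𝟙 X) (𝟙 X) ≫ X ◁ MonoidalClosed.curry (fst X X ≫ g) ≫ (ihom.ev X).app Y := by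
        rw [lift_whiskerLeft_assoc, Category.id_comp]
    _ = g := by rw [this]; simp

theorem epsilonAt_comp_evAt (g : R.K ⟶ R.K) (i : Fin 2) :
    R.epsilonAt g ≫ evAt R.K i = lift (𝟙 _) (MonoidalClosed.curry (fst R.K R.K ≫ g) ≫
      lift (𝟙 _) (SSet.const (SSet.stdSimplex.obj₀Equiv.symm i)) ≫ R.ε.h) ≫
        (ihom.ev R.K).app R.K := by
  rw [epsilonAt, curry_comp_evAt]
  simp only [← Category.assoc, comp_lift, lift_fst, lift_snd, ← MonoidalClosed.curry_natural_left,
    whiskerLeft_fst, Category.comp_id, SSet.comp_const]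

theorem epsilonAt_comp_evAt_zero (g : R.K ⟶ R.K) :
    R.epsilonAt g ≫ evAt R.K 0 =
      R.app (MonoidalClosed.curry (fst R.K R.K ≫ g) ≫ R.G) (𝟙 R.K) := by
  rw [epsilonAt_comp_evAt, app, Category.assoc]
  exact congrArg (fun k => lift (𝟙 _) (MonoidalClosed.curry (fst R.K R.K ≫ g) ≫ k) ≫
    (ihom.ev R.K).app R.K) R.ε.h₀

theorem epsilonAt_comp_evAt_one (g : R.K ⟶ R.K) : R.epsilonAt g ≫ evAt R.K 1 = g := by
  rw [epsilonAt_comp_evAt]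
  conv_rhs => rw [← lift_curry_fst_comp_ev g,
    ← Category.comp_id (MonoidalClosed.curry (fst R.K R.K ≫ g))]
  exact congrArg (fun k => lift (𝟙 _) (MonoidalClosed.curry (fst R.K R.K ≫ g) ≫ k) ≫
    (ihom.ev R.K).app R.K) R.ε.h₁

/-- With all variables but `x` constant, the body of `λx.P` ignores the parameter complex, so its
transpose is the constant map at `⟦P⟧_{[·/x]ρ}`. -/
theorem epsilonAt_interpFun_comp_evAt_zero (x : Var) (P : Term) (ρ : R.Valuation) :
    R.epsilonAt (R.interpFun x P ρ) ≫ evAt R.K 0 = R.appLeft (R.interpSimplex (.lam x P) ρ) := by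
  rw [epsilonAt_comp_evAt_zero, appLeft, const_interpSimplex, interp, interpFun, comp_interp]
  congr 4
  funext v
  by_cases hx : v = x
  · subst hx; simp only [updateVal_self, Category.comp_id]
  · simp only [updateVal_of_ne _ _ _ hx, SSet.comp_const]

/-! ### Redexes and contracta of λ-terms at vertices -/

theorem interpSimplex_app (L M : Term) (ρ : R.Valuation) :
    R.interpSimplex (.app L M) ρ =
      (R.appLeft (R.interpSimplex L ρ)).app _ (R.interpSimplex M ρ) := by
  apply SSet.yonedaEquiv.symm.injective
  rw [← yonedaEquiv_symm_comp, appLeft, comp_app, SSet.comp_const, ← yonedaEquiv_symm_eq_const]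
  simp only [interpSimplex, interp, Equiv.symm_apply_apply, Category.comp_id]

theorem interpSimplex_subst (M : Term) (x : Var) (P : Term) (ρ : R.Valuation) :
    R.interpSimplex (Term.subst M x P) ρ =
      (R.interpFun x P ρ).app _ (R.interpSimplex M ρ) := by
  apply SSet.yonedaEquiv.symm.injective
  rw [← yonedaEquiv_symm_comp, interpFun, comp_interp]
  simp only [interpSimplex, Term.subst, interp_substAll, Equiv.symm_apply_apply]
  congr 1
  funext v
  by_cases hx : v = x
  · subst hx; simp only [updateVal_self, Function.update_self, Category.comp_id]
  · simp only [updateVal_of_ne _ _ _ hx, Function.update_of_ne hx, interp, SSet.comp_const,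
      yonedaEquiv_symm_eq_const]

/-- As `y` is not free in `M`, the body `My` is the uncurried form of `⟦M⟧ ≫ F`, and currying undoes
this. -/
theorem interp_lam_app_var {X : SSet.{u}} (M : Term) (y : Var) (hy : y ∉ M.FV)
    (ρ : Var → (X ⟶ R.K)) :
    R.interp (.lam y (.app M (.var y))) ρ = R.interp M ρ ≫ R.F ≫ R.G := by
  have h : R.interp M (R.updateVal (fun v => snd R.K X ≫ ρ v) y (fst R.K X)) =
      snd R.K X ≫ R.interp M ρ := by
    rw [comp_interp]
    refine R.interp_congr M _ _ fun v hv => updateVal_of_ne _ _ _ ?_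
    rintro rfl
    exact hy hv
  simp only [interp, updateVal_self, h, app]
  rw [← Category.assoc, ← MonoidalClosed.curry_uncurry (R.interp M ρ ≫ R.F),
    MonoidalClosed.uncurry_eq]
  congr 3

theorem interpSimplex_lam_app_var (M : Term) (y : Var) (hy : y ∉ M.FV) (ρ : R.Valuation) :
    R.interpSimplex (.lam y (.app M (.var y))) ρ = (R.F ≫ R.G).app _ (R.interpSimplex M ρ) := by
  apply SSet.yonedaEquiv.symm.injective
  rw [← yonedaEquiv_symm_comp]
  simp only [interpSimplex, interp_lam_app_var _ _ _ hy, Equiv.symm_apply_apply]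

end ReflexiveKan

/-! ### Interpretation of conversions -/

namespace Conv

variable (E : ExtensionalKan.{u}) (ρ : E.Valuation)

theorem interp_src : ∀ {n : ℕ} (t : Conv.{u} (n + 1)), t.src.interp E ρ = (t.interp E ρ).src
  | 0, conv _ _ _ => rfl
  | _ + 1, conv _ _ _ => rfl

theorem interp_tgt : ∀ {n : ℕ} (t : Conv.{u} (n + 1)), t.tgt.interp E ρ = (t.interp E ρ).tgt
  | 0, conv _ _ _ => rfl
  | _ + 1, conv _ _ _ => rfl

theorem betaRedex_eq_map (x : Var) (P : Term) : ∀ {n : ℕ} (t : Conv.{u} n),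
    t.betaRedex E ρ x P = (t.interp E ρ).map (E.appLeft (E.interpSimplex (.lam x P) ρ))
  | _, term _ => E.interpSimplex_app _ _ _
  | _, conv _ _ _ => rfl

theorem betaContractum_eq_map (x : Var) (P : Term) : ∀ {n : ℕ} (t : Conv.{u} n),
    t.betaContractum E ρ x P = (t.interp E ρ).map (E.interpFun x P ρ)
  | _, term _ => E.interpSimplex_subst _ _ _ _
  | _, conv _ _ _ => rfl

theorem etaRedex_eq_map (y : Var) : ∀ {n : ℕ} (t : Conv.{u} n), t.NotFree y →
    t.etaRedex E ρ y = (t.interp E ρ).map (E.F ≫ E.G)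
  | _, term _, h => E.interpSimplex_lam_app_var _ _ h _
  | _, conv _ _ _, _ => rfl

theorem NotFree.src {y : Var} : ∀ {n : ℕ} {t : Conv.{u} (n + 1)}, t.NotFree y → t.src.NotFree y
  | 0, conv _ _ _, h => h.1
  | _ + 1, conv M N c, h => ⟨h.1, h.2.1, fun E ρ a => by
      simpa only [← interp_src] using! congrArg Cell.src (h.2.2 E ρ a)⟩

theorem NotFree.tgt {y : Var} : ∀ {n : ℕ} {t : Conv.{u} (n + 1)}, t.NotFree y → t.tgt.NotFree y
  | 0, conv _ _ _, h => h.2.1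
  | _ + 1, conv M N c, h => ⟨h.1, h.2.1, fun E ρ a => by
      simpa only [← interp_tgt] using! congrArg Cell.tgt (h.2.2 E ρ a)⟩

end Conv

/-! ### Inverses of homotopies -/

section

open Simplicial SSet

/-- An edge of a Kan complex has a right inverse. -/
theorem exists_right_inverse {Z : SSet.{u}} [KanComplex Z] (e : (Δ[1] : SSet.{u}) ⟶ Z) :
    ∃ T : (Δ[2] : SSet.{u}) ⟶ Z, stdSimplex.δ 2 ≫ T = e ∧
      stdSimplex.δ 1 ≫ T = stdSimplex.σ 0 ≫ stdSimplex.δ 1 ≫ e := by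
  let f (j : Fin 3) (_ : j ≠ 0) : (Δ[1] : SSet.{u}) ⟶ Z :=
    -- Entry 0 stands for the missing face and is a dummy value.
    ![e, stdSimplex.σ 0 ≫ stdSimplex.δ 1 ≫ e, e] j
  have hf : horn.IsCompatible f := by
    have h : (stdSimplex.δ 1 : (Δ[0] : SSet.{u}) ⟶ Δ[1]) ≫ stdSimplex.σ 0 = 𝟙 _ :=
      stdSimplex.δ_comp_σ_succ (i := 0)
    have h₁₂ : stdSimplex.δ 1 ≫ stdSimplex.σ 0 ≫ stdSimplex.δ 1 ≫ e = stdSimplex.δ 1 ≫ e := by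
      rw [reassoc_of% h]
    rw [horn.isCompatible_iff]
    intro j k hj hk hjk
    fin_cases j <;> fin_cases k <;> first | (exact h₁₂) | (simp at hj hk hjk)
  obtain ⟨T, hT⟩ := hf.exists_lift_of_kanComplex
  exact ⟨T, hT 2 (by decide), hT 1 (by decide)⟩

/-- In a Kan complex, a right inverse of an edge is a left inverse. -/
theorem exists_left_inverse {Z : SSet.{u}} [KanComplex Z] (T : (Δ[2] : SSet.{u}) ⟶ Z)
    (e e' : (Δ[1] : SSet.{u}) ⟶ Z) (h₂ : stdSimplex.δ 2 ≫ T = e) (h₀ : stdSimplex.δ 0 ≫ T = e')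
    (h₁ : stdSimplex.δ 1 ≫ T = stdSimplex.σ 0 ≫ stdSimplex.δ 1 ≫ e) :
    ∃ T' : (Δ[2] : SSet.{u}) ⟶ Z, stdSimplex.δ 2 ≫ T' = e' ∧ stdSimplex.δ 0 ≫ T' = e ∧
      stdSimplex.δ 1 ≫ T' = stdSimplex.σ 0 ≫ stdSimplex.δ 0 ≫ e := by
  have δσ₀₀ : (stdSimplex.δ 0 : (Δ[1] : SSet.{u}) ⟶ Δ[2]) ≫ stdSimplex.σ 0 = 𝟙 _ :=
    stdSimplex.δ_comp_σ_self (i := 0)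
  have δσ₁₀ : (stdSimplex.δ 1 : (Δ[1] : SSet.{u}) ⟶ Δ[2]) ≫ stdSimplex.σ 0 = 𝟙 _ :=
    stdSimplex.δ_comp_σ_succ (i := 0)
  have δσ₁₁ : (stdSimplex.δ 1 : (Δ[1] : SSet.{u}) ⟶ Δ[2]) ≫ stdSimplex.σ 1 = 𝟙 _ :=
    stdSimplex.δ_comp_σ_self (i := 1)
  have δσ₂₁ : (stdSimplex.δ 2 : (Δ[1] : SSet.{u}) ⟶ Δ[2]) ≫ stdSimplex.σ 1 = 𝟙 _ :=
    stdSimplex.δ_comp_σ_succ (i := 1)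
  have δσ₂₀ : (stdSimplex.δ 2 : (Δ[1] : SSet.{u}) ⟶ Δ[2]) ≫ stdSimplex.σ 0 =
      stdSimplex.σ 0 ≫ stdSimplex.δ 1 :=
    stdSimplex.δ_comp_σ_of_gt (i := 1) (j := 0) (by decide)
  have δσ₀₁ : (stdSimplex.δ 0 : (Δ[1] : SSet.{u}) ⟶ Δ[2]) ≫ stdSimplex.σ 1 =
      stdSimplex.σ 0 ≫ stdSimplex.δ 0 :=
    stdSimplex.δ_comp_σ_of_le (i := 0) (j := 0) (by decide)
  let f (j : Fin 4) (_ : j ≠ 0) : (Δ[2] : SSet.{u}) ⟶ Z :=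
    -- Entry 0 is again a dummy value.
    ![T, stdSimplex.σ 0 ≫ e, stdSimplex.σ 1 ≫ e, T] j
  have hf : horn.IsCompatible f := by
    have h₁₂ : stdSimplex.δ 1 ≫ stdSimplex.σ 0 ≫ e = stdSimplex.δ 1 ≫ stdSimplex.σ 1 ≫ e := by
      rw [reassoc_of% δσ₁₀, reassoc_of% δσ₁₁]
    have h₁₃ : stdSimplex.δ 2 ≫ stdSimplex.σ 0 ≫ e = stdSimplex.δ 1 ≫ T := by
      rw [reassoc_of% δσ₂₀, h₁]
    have h₂₃ : stdSimplex.δ 2 ≫ stdSimplex.σ 1 ≫ e = stdSimplex.δ 2 ≫ T := by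
      rw [reassoc_of% δσ₂₁, h₂]
    rw [horn.isCompatible_iff]
    intro j k hj hk hjk
    fin_cases j <;> fin_cases k <;> first
      | (exact h₁₂)
      | (exact h₁₃)
      | (exact h₂₃)
      | (simp at hj hk hjk)
  obtain ⟨W, hW⟩ := hf.exists_lift_of_kanComplex
  have hW₁ : stdSimplex.δ 1 ≫ W = stdSimplex.σ 0 ≫ e := hW 1 (by decide)
  have hW₂ : stdSimplex.δ 2 ≫ W = stdSimplex.σ 1 ≫ e := hW 2 (by decide)
  have hW₃ : stdSimplex.δ 3 ≫ W = T := hW 3 (by decide)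
  have δδ₂ : (stdSimplex.δ 2 : (Δ[1] : SSet.{u}) ⟶ Δ[2]) ≫ stdSimplex.δ 0 =
      stdSimplex.δ 0 ≫ stdSimplex.δ 3 :=
    (stdSimplex.δ_comp_δ (i := 0) (j := 2) (by decide)).symm
  have δδ₀ : (stdSimplex.δ 0 : (Δ[1] : SSet.{u}) ⟶ Δ[2]) ≫ stdSimplex.δ 0 =
      stdSimplex.δ 0 ≫ stdSimplex.δ 1 :=
    (stdSimplex.δ_comp_δ (i := 0) (j := 0) (by decide)).symm
  have δδ₁ : (stdSimplex.δ 1 : (Δ[1] : SSet.{u}) ⟶ Δ[2]) ≫ stdSimplex.δ 0 =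
      stdSimplex.δ 0 ≫ stdSimplex.δ 2 :=
    (stdSimplex.δ_comp_δ (i := 0) (j := 1) (by decide)).symm
  refine ⟨stdSimplex.δ 0 ≫ W, ?_, ?_, ?_⟩
  · rw [reassoc_of% δδ₂, hW₃, h₀]
  · rw [reassoc_of% δδ₀, hW₁, reassoc_of% δσ₀₀]
  · rw [reassoc_of% δδ₁, hW₂, reassoc_of% δσ₀₁]

theorem curry_fst_comp {X Y : SSet.{u}} (k : X ⊗ (Δ[1] : SSet.{u}) ⟶ Y) (f : X ⟶ Y) (i : Fin 2)
    (v : (Δ[0] : SSet.{u}) ⟶ Δ[1]) (hv : v = const (stdSimplex.obj₀Equiv.symm i))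
    (h : lift (𝟙 X) (const (stdSimplex.obj₀Equiv.symm i)) ≫ k = f) :
    stdSimplex.σ 0 ≫ v ≫ MonoidalClosed.curry k = MonoidalClosed.curry (fst _ _ ≫ f) := by
  rw [← MonoidalClosed.curry_natural_left, ← MonoidalClosed.curry_natural_left, hv, ← h]
  congr 1

/-- By currying, a homotopy is an edge of the Kan complex `Fun X Y`, and the two horn fillings apply
there. -/
theorem exists_areInverse {X Y : SSet.{u}} [KanComplex Y] {f g : X ⟶ Y}
    (H : Homotopy f g) : ∃ H' : Homotopy g f, AreInverse H H' := by
  have hf : stdSimplex.σ 0 ≫ stdSimplex.δ 1 ≫ MonoidalClosed.curry H.h =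
      MonoidalClosed.curry (fst _ _ ≫ f) :=
    curry_fst_comp _ _ 0 _ stdSimplex.δ_one_eq_const H.h₀
  have hg : stdSimplex.σ 0 ≫ stdSimplex.δ 0 ≫ MonoidalClosed.curry H.h =
      MonoidalClosed.curry (fst _ _ ≫ g) :=
    curry_fst_comp _ _ 1 _ stdSimplex.δ_zero_eq_const H.h₁
  obtain ⟨T, hT₂, hT₁⟩ := exists_right_inverse (MonoidalClosed.curry H.h)
  obtain ⟨T', hT'₂, hT'₀, hT'₁⟩ := exists_left_inverse T _ _ hT₂ rfl hT₁
  rw [hf] at hT₁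
  rw [hg] at hT'₁
  have key (i : Fin 3) (S : (Δ[2] : SSet.{u}) ⟶ Fun X Y) (k : X ⊗ (Δ[1] : SSet.{u}) ⟶ Y)
      (h : stdSimplex.δ i ≫ S = MonoidalClosed.curry k) :
      X ◁ stdSimplex.δ i ≫ MonoidalClosed.uncurry S = k := by
    rw [← MonoidalClosed.uncurry_natural_left, h, MonoidalClosed.uncurry_curry]
  have vertex (i j : Fin 3) (k l : Fin 2) (h : i.succAbove k = j.succAbove l) :
      lift (𝟙 X) (const (stdSimplex.obj₀Equiv.symm k)) ≫ X ◁ stdSimplex.δ i =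
        lift (𝟙 X) (const (stdSimplex.obj₀Equiv.symm l)) ≫ X ◁ stdSimplex.δ j := by
    rw [lift_whiskerLeft, lift_whiskerLeft, const_comp, const_comp]
    congr 2
    apply stdSimplex.obj₀Equiv.injective
    exact h
  let H' : Homotopy g f :=
    { h := X ◁ stdSimplex.δ 0 ≫ MonoidalClosed.uncurry T
      h₀ := by
        refine Eq.trans ?_ H.h₁
        rw [← key _ _ _ hT₂]
        -- The vertex 1 of `Δ[2]` is the start of face 0 and the end of face 2.
        exact congrArg (· ≫ MonoidalClosed.uncurry T) (vertex 0 2 0 1 (by decide))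
      h₁ := by
        refine Eq.trans ?_ (show ι₁ ≫ fst _ _ ≫ f = f by simp)
        rw [← key _ _ _ hT₁]
        -- The vertex 2 of `Δ[2]` is the end of both face 0 and face 1.
        exact congrArg (· ≫ MonoidalClosed.uncurry T) (vertex 0 1 1 1 (by decide))
      rel := by
        ext m ⟨⟨x, hx⟩, _⟩
        exact hx.elim }
  refine ⟨H', ⟨MonoidalClosed.uncurry T, key _ _ _ hT₂, rfl, key _ _ _ hT₁⟩,
    ⟨MonoidalClosed.uncurry T', ?_, key _ _ _ hT'₀, key _ _ _ hT'₁⟩⟩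
  rw [← MonoidalClosed.uncurry_natural_left, hT'₂, MonoidalClosed.uncurry_natural_left]

end

end HigherLambda

end

theorem corollary2p1 {n : ℕ} (r s : Conv.{u} n) (t : Conv.{u} (n + 1)) (ht : t.Between r s)
    (E : ExtensionalKan.{u}) (ρ : E.Valuation) :
    (∀ (x : Var) (P : Term),
      CommutesVia (t.beta E ρ x P)
        (r.betaRedex E ρ x P) (r.betaContractum E ρ x P)
        (s.betaRedex E ρ x P) (s.betaContractum E ρ x P)
        (r.beta E ρ x P) (s.beta E ρ x P)
        (t.betaRedex E ρ x P) (t.betaContractum E ρ x P)) ∧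
    (∃ θ : SSet.Homotopy (E.F ≫ E.G) (𝟙 E.K), AreInverse E.η θ) ∧
    (∀ (y : Var), t.NotFree y →
      ∀ θ : SSet.Homotopy (E.F ≫ E.G) (𝟙 E.K), AreInverse E.η θ →
        CommutesVia (t.eta E ρ θ)
          (r.etaRedex E ρ y) (r.interp E ρ)
          (s.etaRedex E ρ y) (s.interp E ρ)
          (r.eta E ρ θ) (s.eta E ρ θ)
          (t.etaRedex E ρ y) (t.interp E ρ)) := by
  obtain ⟨rfl, rfl⟩ := ht
  refine ⟨fun x P => ?_, ?_, fun y hy θ _ => ?_⟩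
  · simp only [Conv.beta, Conv.betaRedex_eq_map, Conv.betaContractum_eq_map, Conv.interp_src,
      Conv.interp_tgt]
    exact commutesVia_map _ _ _ (E.epsilonAt_interpFun_comp_evAt_zero x P ρ)
      (E.epsilonAt_comp_evAt_one _) _
  · have := E.kan
    exact exists_areInverse E.η
  · have h := commutesVia_map _ _ _ (component_comp_evAt_zero θ) (component_comp_evAt_one θ)
      (t.interp E ρ)
    simpa only [Conv.eta, Conv.etaRedex_eq_map E ρ y _ hy, Conv.etaRedex_eq_map E ρ y _ hy.src,
      Conv.etaRedex_eq_map E ρ y _ hy.tgt, Conv.interp_src, Conv.interp_tgt, Cell.map_id] using h
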